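/- Let $\mathbb D$ be the open unit disk and $\mathbb T=\partial\mathbb D$. Let $\mu,\lambda\ge 0$ be finite positive (regular) Borel measures on $\mathbb T$. All forms and inner products are conjugate linear in the first argument. *Notation.* $H^2(\lambda)$ is the closure of the analytic polynomials in $L^2(\lambda)$. $A(\mathbb D)\subseteq C(\mathbb T)$ is the disk algebra (boundary values of functions analytic in $\mathbb D$ and continuous on $\overline{\mathbb D}$), which maps canonically onto a dense subspace of $H^2(\lambda)$. For $z\in\mathbb D$ let $k_z(\zeta)=(1-\bar z\zeta)^{-1}$. Let $\mathscr H^+(\mu)$ be the reproducing kernel Hilbert space on $\mathbb D$ of the Cauchy transforms $z\mapsto\int_{\mathbb T}\frac{h(\zeta)}{1-z\bar\zeta}\,\mu(d\zeta)$, $h\in H^2(\mu)$, with the inner product of $L^2(\mu)$ transported to it, and let $\mathrm{int}(\mu,\lambda)=\mathscr H^+(\mu)\cap\mathscr H^+(\lambda)$. Let $\mathfrak q_\mu(g,h)=\int_{\mathbb T}\overline{g}\,h\,d\mu$ with form domain $A(\mathbb D)$, regarded as a densely defined positive semi-definite form in $H^2(\lambda)$. A positive semi-definite form $\mathfrak q$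 on $A(\mathbb D)$ is *closeable* in $H^2(\lambda)$ if it has a closed extension, i.e. there is a positive semi-definite form $\mathfrak t$ on a dense subspace $\mathrm{Dom}\,\mathfrak t\subseteq H^2(\lambda)$ containing the image of $A(\mathbb D)$, such that $\mathrm{Dom}\,\mathfrak t$ is complete for the inner product $\langle\cdot,\cdot\rangle+\mathfrak t(\cdot,\cdot)$ and $\mathfrak t(a,b)=\mathfrak q(a,b)$ for all $a,b\in A(\mathbb D)$ (when $A(\mathbb D)\to H^2(\lambda)$ is not injective, this includes that $\mathfrak q$ descends to the image). Write $\mathfrak p\le\mathfrak q$ if $\mathfrak p(a,a)\le\mathfrak q(a,a)$ for all $a\in A(\mathbb D)$. A *Simon–Lebesgue decomposition* of $\mathfrak q_\mu$ in $H^2(\lambda)$ is $\mathfrak q_\mu=\mathfrak q_{ac}+\mathfrak q_s$ with $0\le\mathfrak q_{ac},\mathfrak q_s\le\mathfrak q_\mu$ such that $\mathfrak q_{ac}$ is the largest closeable positive semi-definite form $\le\mathfrak q_\mu$, and $0$ is the only closeable positive semi-definite form $\le\mathfrak q_s$. For a form $0\le\mathfrak q\le\mathfrak q_\mu$ on $A(\mathbb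 D)$, let $H^2(\mathfrak q)$ be the Hilbert space completion of $A(\mathbb D)$, modulo vectors of zero length, for the pre-inner product $\mathfrak q$, and let $\mathscr H^+(\mathfrak q)$ be the reproducing kernel Hilbert space of the functions $z\mapsto\mathfrak q(k_z,h)$ on $\mathbb D$, $h\in H^2(\mathfrak q)$, with the inner product of $H^2(\mathfrak q)$ transported to it. **Corollary.** The form $\mathfrak q_\mu$ has exactly one Simon–Lebesgue decomposition $\mathfrak q_\mu=\mathfrak q_{ac}+\mathfrak q_s$ in $H^2(\lambda)$, and for it $$\mathscr H^+(\mu)=\mathscr H^+(\mathfrak q_{ac})\oplus\mathscr H^+(\mathfrak q_s)$$ as an orthogonal direct sum: both summands are contained isometrically in $\mathscr H^+(\mu)$, they are mutually orthogonal there, and their sum is $\mathscr H^+(\mu)$. In particular, $\mathscr H^+(\mathfrak q_s)\cap\mathrm{int}(\mu,\lambda)=\{0\}$. -/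

import Mathlib

open MeasureTheory Filter Topology
open scoped ComplexConjugate ComplexOrder

noncomputable section

/-! ### Positive forms in a Hilbert space, and their Simon–Lebesgue decomposition

Forms are conjugate linear in the first and linear in the second argument. -/

/-- Sesquilinear forms on a complex vector space `V`. -/
abbrev SesqForm (V : Type*) [AddCommGroup V] [Module ℂ V] : Type _ := V →ₗ⋆[ℂ] V →ₗ[ℂ] ℂ

namespace SesqForm

variable {V : Type*} [AddCommGroup V] [Module ℂ V]

/-- `q` is positive semi-definite: `q (x, x)` is real and nonnegative for all `x`. -/
def Nonneg (q : SesqForm V) : Prop := ∀ x, 0 ≤ q x x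

/-- `p ≤ q` in the sense of forms on a common domain: `p (x, x) ≤ q (x, x)` for all `x`
(for the partial order of `ℂ`, in which comparable numbers differ by a real number). -/
def Dominated (p q : SesqForm V) : Prop := ∀ x, p x x ≤ q x x

/-- A positive semi-definite form is Hermitian. -/
theorem Nonneg.conj_symm {q : SesqForm V} (hq : q.Nonneg) (x y : V) : conj (q y x) = q x y := by
  have key : ∀ u : V, (q u u).im = 0 := fun u => ((Complex.nonneg_iff.1 (hq u)).2).symm
  have h1 := key (x + y)
  have h2 := key (x + Complex.I • y)
  have hx := key x
  have hy := key y
  simp only [map_add, LinearMap.add_apply, LinearMap.map_smulₛₗ, LinearMap.smul_apply,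
    smul_eq_mul, Complex.add_im, Complex.add_re, Complex.mul_im, Complex.mul_re, Complex.conj_I,
    Complex.I_re, Complex.I_im, RingHom.id_apply, Complex.neg_re, Complex.neg_im] at h1 h2
  apply Complex.ext
  · simp only [Complex.conj_re]; linarith
  · simp only [Complex.conj_im]; linarith

/-- The pre-inner product of a positive semi-definite form. -/
@[reducible] def Nonneg.core {q : SesqForm V} (hq : q.Nonneg) : PreInnerProductSpace.Core ℂ V where
  inner x y := q x y
  conj_inner_symm x y := hq.conj_symm x y
  re_inner_nonneg x := (Complex.nonneg_iff.1 (hq x)).1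
  add_left x y z := by simp
  smul_left x y r := by simp

/-- The vector space `V` with the pre-inner product `q`. -/
def Pre (q : SesqForm V) (_hq : q.Nonneg) : Type _ := V

variable (q : SesqForm V) (hq : q.Nonneg)

instance : SeminormedAddCommGroup (q.Pre hq) :=
  @InnerProductSpace.Core.toSeminormedAddCommGroup ℂ V _ _ _ hq.core
instance : InnerProductSpace ℂ (q.Pre hq) := InnerProductSpace.ofCore (F := V) hq.core

/-- The Hilbert space completion of `V` modulo the vectors of zero length,
with respect to the pre-inner product `q`. -/
abbrev HilbertCompletion : Type _ := UniformSpace.Completion (q.Pre hq)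

/-- The canonical map of `V` into the Hilbert space completion. -/
def toCompletion (x : V) : q.HilbertCompletion hq :=
  ((show q.Pre hq from x) : UniformSpace.Completion (q.Pre hq))

theorem inner_toCompletion (x y : V) :
    inner ℂ (q.toCompletion hq x) (q.toCompletion hq y) = q x y :=
  UniformSpace.Completion.inner_coe _ _

end SesqForm

/-- A closed positive semi-definite form in a Hilbert space `H`, with dense form domain. -/
structure ClosedForm (H : Type*) [NormedAddCommGroup H] [InnerProductSpace ℂ H] where
  /-- the form domain -/
  domain : Submodule ℂ H
  dense_domain : Dense (domain : Set H)
  /-- the form -/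
  form : SesqForm domain
  nonneg : form.Nonneg
  /-- Every Cauchy sequence for the norm of the inner product `⟪x, y⟫ + form (x, y)` on the
  domain converges in the domain for this norm. -/
  complete : ∀ u : ℕ → domain,
    Tendsto (fun p : ℕ × ℕ =>
      ‖u p.1 - u p.2‖ ^ 2 + (form (u p.1 - u p.2) (u p.1 - u p.2)).re) atTop (𝓝 0) →
    ∃ x : domain, Tendsto (fun n => ‖u n - x‖ ^ 2 + (form (u n - x) (u n - x)).re) atTop (𝓝 0)

namespace SesqForm

variable {V : Type*} [AddCommGroup V] [Module ℂ V]
variable {H : Type*} [NormedAddCommGroup H] [InnerProductSpace ℂ H]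

/-- The form `q` with domain `V`, regarded as a form in `H` through the linear map `J : V → H`
with dense range, is closeable (absolutely continuous): it has a closed extension. If `J` is the
inclusion of a dense subspace, then this is the usual notion. If `J` is not injective, then it
includes that `q` descends to a form with domain `J V`. -/
def Closeable (J : V →ₗ[ℂ] H) (q : SesqForm V) : Prop :=
  ∃ (t : ClosedForm H) (hJ : ∀ x, J x ∈ t.domain), ∀ x y, t.form ⟨J x, hJ x⟩ ⟨J y, hJ y⟩ = q x y

/-- `q = q_ac + q_s` is the Simon–Lebesgue decomposition of the positive semi-definite form `q` in
`H`: both parts are positive semi-definite forms bounded above by `q`, the form `q_ac` is the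
largest closeable form bounded above by `q`, and `q_s` is singular, that is, the only closeable
positive semi-definite form that it dominates is `0`. -/
structure IsSimonLebesgueDecomposition (J : V →ₗ[ℂ] H) (q q_ac q_s : SesqForm V) : Prop where
  add_eq : q = q_ac + q_s
  nonneg_ac : q_ac.Nonneg
  nonneg_s : q_s.Nonneg
  ac_le : q_ac.Dominated q
  s_le : q_s.Dominated q
  closeable_ac : q_ac.Closeable J
  maximal_ac : ∀ p : SesqForm V, p.Nonneg → p.Closeable J → p.Dominated q → p.Dominated q_ac
  singular_s : ∀ p : SesqForm V, p.Nonneg → p.Closeable J → p.Dominated q_s → p = 0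

end SesqForm

/-! ### The disk algebra, analytic polynomials and Szegő kernels on the circle -/

instance : MeasurableSpace Circle := borel Circle
instance : BorelSpace Circle := ⟨rfl⟩

/-- The disk algebra `A(𝔻)`, as a subspace of the continuous functions on the circle: boundary
values of the functions that are analytic in the open disk and continuous on its closure. -/
def diskAlgebra : Submodule ℂ C(Circle, ℂ) where
  carrier := {a | ∃ F : ℂ → ℂ, DiffContOnCl ℂ F (Metric.ball 0 1) ∧ ∀ ζ : Circle, F ζ = a ζ}
  zero_mem' := ⟨fun _ => 0, diffContOnCl_const, fun _ => rfl⟩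
  add_mem' := by
    rintro a b ⟨F, hF, ha⟩ ⟨G, hG, hb⟩
    exact ⟨F + G, hF.add hG, fun ζ => by simp [ha, hb]⟩
  smul_mem' := by
    rintro c a ⟨F, hF, ha⟩
    exact ⟨c • F, hF.const_smul c, fun ζ => by simp [ha]⟩

/-- The monomial `ζ ^ n` on the circle. -/
def circleMonomial (n : ℕ) : C(Circle, ℂ) := ⟨fun ζ => (ζ : ℂ) ^ n, by fun_prop⟩

/-- The analytic polynomials, as functions on the circle. -/
def analyticPolynomials : Submodule ℂ C(Circle, ℂ) := Submodule.span ℂ (Set.range circleMonomial)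

theorem one_sub_mul_circle_ne_zero {w : ℂ} (hw : ‖w‖ < 1) (ζ : Circle) : 1 - w * (ζ : ℂ) ≠ 0 := by
  intro h
  have h1 : w * (ζ : ℂ) = 1 := (sub_eq_zero.1 h).symm
  have h2 : ‖w‖ = 1 := by simpa [Circle.norm_coe] using congrArg norm h1
  linarith

/-- The Szegő kernel vector `k_z (ζ) = (1 - conj z * ζ)⁻¹`, for `z` in the open disk. -/
def szegoKernel (z : Complex.UnitDisc) : C(Circle, ℂ) where
  toFun ζ := (1 - conj (z : ℂ) * (ζ : ℂ))⁻¹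
  continuous_toFun := by
    refine Continuous.inv₀ (by fun_prop) fun ζ => one_sub_mul_circle_ne_zero ?_ ζ
    simpa using z.norm_lt_one

theorem szegoKernel_mem (z : Complex.UnitDisc) : szegoKernel z ∈ diskAlgebra := by
  refine ⟨fun w => (1 - conj (z : ℂ) * w)⁻¹, ?_, fun ζ => rfl⟩
  have hne : ∀ w ∈ closure (Metric.ball (0 : ℂ) 1), 1 - conj (z : ℂ) * w ≠ 0 := by
    intro w hw h
    rw [closure_ball _ one_ne_zero, mem_closedBall_zero_iff] at hw
    have h1 : conj (z : ℂ) * w = 1 := (sub_eq_zero.1 h).symm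
    have h2 : ‖(z : ℂ)‖ * ‖w‖ = 1 := by simpa using congrArg norm h1
    nlinarith [z.norm_lt_one, norm_nonneg (z : ℂ), norm_nonneg w]
  refine DiffContOnCl.inv ?_ hne
  exact Differentiable.diffContOnCl (by fun_prop)

/-- The analytic polynomials are dense in the disk algebra for the supremum norm. -/
theorem diskAlgebra_le_closure_polynomials :
    diskAlgebra ≤ analyticPolynomials.topologicalClosure := by
  rintro a ⟨F, hF, hFa⟩
  change a ∈ closure (analyticPolynomials : Set C(Circle, ℂ))
  rw [Metric.mem_closure_iff]
  intro ε hε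
  have hcont : ContinuousOn F (Metric.closedBall 0 1) := hF.continuousOn_ball
  have huc : UniformContinuousOn F (Metric.closedBall 0 1) :=
    (isCompact_closedBall (0 : ℂ) 1).uniformContinuousOn_of_continuous hcont
  obtain ⟨δ, hδ, hδF⟩ := Metric.uniformContinuousOn_iff.1 huc (ε / 4) (by linarith)
  obtain ⟨r, hr0, hr1, hrδ⟩ : ∃ r : ℝ, 0 < r ∧ r < 1 ∧ 1 - r < δ := by
    refine ⟨max (1 / 2) (1 - δ / 2), lt_max_of_lt_left (by norm_num),
      max_lt (by norm_num) (by linarith), ?_⟩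
    have := le_max_right (1 / 2) (1 - δ / 2)
    linarith
  obtain ⟨s, hrs, hs1⟩ := exists_between hr1
  have hps := DiffContOnCl.hasFPowerSeriesOnBall (R := 1) (c := (0 : ℂ)) (f := F)
    (by simpa using hF) one_pos
  set P := cauchyPowerSeries F 0 (1 : NNReal) with hP
  have hs0 : 0 ≤ s := (hr0.trans hrs).le
  lift s to NNReal using hs0
  have hunif := hps.tendstoUniformlyOn (r' := s) (by
    rw [ENNReal.coe_lt_coe, ← NNReal.coe_lt_coe]; exact hs1)
  obtain ⟨n, hn⟩ := (Metric.tendstoUniformlyOn_iff.1 hunif (ε / 4) (by linarith)).exists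
  refine ⟨∑ k ∈ Finset.range n, (P.coeff k * (r : ℂ) ^ k) • circleMonomial k, ?_, ?_⟩
  · exact Submodule.sum_mem _ fun k _ => Submodule.smul_mem _ _ (Submodule.subset_span ⟨k, rfl⟩)
  · refine lt_of_le_of_lt ((ContinuousMap.dist_le (by positivity : 0 ≤ ε / 2)).2 fun ζ => ?_)
      (by linarith)
    have hζ : ‖(ζ : ℂ)‖ = 1 := Circle.norm_coe ζ
    have hrζ : ‖(r : ℂ) * ζ‖ = r := by simp [Circle.norm_coe, abs_of_pos hr0]
    have h1 : dist (F ζ) (F (r * ζ)) < ε / 4 := by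
      refine hδF _ (by simp [hζ]) _ (by rw [mem_closedBall_zero_iff, hrζ]; exact hr1.le) ?_
      have : (ζ : ℂ) - r * ζ = ((1 - r : ℝ) : ℂ) * ζ := by push_cast; ring
      rw [dist_eq_norm, this, norm_mul, hζ, mul_one, Complex.norm_real, Real.norm_eq_abs,
        abs_of_pos (by linarith)]
      exact hrδ
    have h2 := hn ((r : ℂ) * ζ) (by rw [mem_ball_zero_iff, hrζ]; exact hrs)
    have h3 : P.partialSum n ((r : ℂ) * ζ) =
        (∑ k ∈ Finset.range n, (P.coeff k * (r : ℂ) ^ k) • circleMonomial k) ζ := by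
      rw [FormalMultilinearSeries.partialSum, ContinuousMap.sum_apply]
      refine Finset.sum_congr rfl fun k _ => ?_
      rw [FormalMultilinearSeries.apply_eq_pow_smul_coeff]
      simp only [circleMonomial, ContinuousMap.smul_apply, ContinuousMap.coe_mk, smul_eq_mul]
      ring
    rw [h3, zero_add] at h2
    rw [← hFa]
    linarith [dist_triangle (F ζ) (F (r * ζ))
      ((∑ k ∈ Finset.range n, (P.coeff k * (r : ℂ) ^ k) • circleMonomial k) ζ)]

/-- The span of the Szegő kernels is dense in the disk algebra for the supremum norm. -/
theorem diskAlgebra_le_closure_szegoKernel :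
    diskAlgebra ≤ (Submodule.span ℂ (Set.range szegoKernel)).topologicalClosure := by
  set S := (Submodule.span ℂ (Set.range szegoKernel)).topologicalClosure with hS
  have hSc : IsClosed (S : Set C(Circle, ℂ)) := Submodule.isClosed_topologicalClosure _
  -- the functions `ζ ^ n / (1 - w * ζ)`
  let g : ℕ → Complex.UnitDisc → C(Circle, ℂ) := fun n w => circleMonomial n * szegoKernel (star w)
  have hg : ∀ n w (ζ : Circle), g n w ζ = (ζ : ℂ) ^ n * (1 - (w : ℂ) * ζ)⁻¹ := by
    intro n w ζ
    simp [g, circleMonomial, szegoKernel]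
  have hg0 : ∀ n, g n 0 = circleMonomial n := by
    intro n; ext ζ; rw [hg]; simp [circleMonomial]
  have hgc : ∀ n, Continuous (g n) := by
    intro n
    refine ContinuousMap.continuous_of_continuous_uncurry _ ?_
    have : (Function.uncurry fun w ζ => g n w ζ) =
        fun p : Complex.UnitDisc × Circle => (p.2 : ℂ) ^ n * (1 - (p.1 : ℂ) * p.2)⁻¹ := by
      ext ⟨w, ζ⟩; exact hg n w ζ
    rw [this]
    have hc := Complex.UnitDisc.continuous_coe
    refine Continuous.mul (by fun_prop) (Continuous.inv₀ (by fun_prop) fun p => ?_)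
    exact one_sub_mul_circle_ne_zero p.1.norm_lt_one p.2
  have hmem : ∀ n w, g n w ∈ S := by
    intro n
    induction n with
    | zero =>
      intro w
      have : g 0 w = szegoKernel (star w) := by ext ζ; simp [g, circleMonomial]
      rw [this]
      exact Submodule.le_topologicalClosure _ (Submodule.subset_span ⟨_, rfl⟩)
    | succ n ih =>
      have hne : ∀ w : Complex.UnitDisc, w ≠ 0 → g (n + 1) w ∈ S := by
        intro w hw
        have hw' : (w : ℂ) ≠ 0 := by simpa using hw
        have : g (n + 1) w = ((w : ℂ)⁻¹) • (g n w - g n 0) := by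
          ext ζ
          have h1 := one_sub_mul_circle_ne_zero w.norm_lt_one ζ
          rw [hg0, ContinuousMap.smul_apply, ContinuousMap.sub_apply, hg, hg, smul_eq_mul]
          simp only [circleMonomial, ContinuousMap.coe_mk]
          field_simp
          ring
        rw [this]
        exact S.smul_mem _ (S.sub_mem (ih w) (ih 0))
      intro w
      by_cases hw : w = 0
      · subst hw
        let v : ℕ → Complex.UnitDisc := fun k =>
          Complex.UnitDisc.mk ((1 / ((k : ℝ) + 2) : ℝ) : ℂ) (by
            rw [Complex.norm_real, Real.norm_of_nonneg (by positivity), div_lt_one (by positivity)]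
            linarith [(Nat.cast_nonneg k : (0 : ℝ) ≤ k)])
        have hv : Tendsto v atTop (𝓝 0) := by
          rw [Complex.UnitDisc.isEmbedding_coe.tendsto_nhds_iff]
          have h0 : Tendsto (fun k : ℕ => (1 / ((k : ℝ) + 2) : ℝ)) atTop (𝓝 0) := by
            have := (tendsto_one_div_add_atTop_nhds_zero_nat (𝕜 := ℝ)).comp (tendsto_add_atTop_nat 1)
            refine this.congr fun k => ?_
            simp only [Function.comp]; push_cast; ring
          have := (Complex.continuous_ofReal.tendsto (0 : ℝ)).comp h0
          simpa [Function.comp_def, v] using this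
        refine hSc.mem_of_tendsto (((hgc (n + 1)).tendsto 0).comp hv) (.of_forall fun k => ?_)
        refine hne _ fun h => ?_
        have := congrArg Complex.UnitDisc.coe h
        have h2 : ((k : ℝ) + 2 : ℝ) ≠ 0 := by positivity
        have h3 : (((1 / ((k : ℝ) + 2) : ℝ) : ℂ)) = 0 := by simpa [v] using this
        rw [Complex.ofReal_eq_zero] at h3
        exact one_div_ne_zero h2 h3
      · exact hne w hw
  refine diskAlgebra_le_closure_polynomials.trans
    (Submodule.topologicalClosure_minimal _ (Submodule.span_le.2 ?_) hSc)
  rintro _ ⟨n, rfl⟩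
  rw [← hg0]
  exact hmem n 0

/-! ### `H²(μ)` and the form of a measure -/

section Measure

variable (μ : Measure Circle) [IsFiniteMeasure μ]

/-- `H²(μ)`, the closure of the analytic polynomials in `L²(μ)`. -/
def hardySpace : Submodule ℂ (Lp ℂ 2 μ) :=
  (analyticPolynomials.map (ContinuousMap.toLp 2 μ ℂ : C(Circle, ℂ) →L[ℂ] Lp ℂ 2 μ).toLinearMap).topologicalClosure

instance : CompleteSpace (hardySpace μ) :=
  (Submodule.isClosed_topologicalClosure _).completeSpace_coe

theorem toLp_mem_hardySpace {a : C(Circle, ℂ)} (ha : a ∈ diskAlgebra) :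
    ContinuousMap.toLp 2 μ ℂ a ∈ hardySpace μ := by
  have h := diskAlgebra_le_closure_polynomials ha
  exact map_mem_closure (ContinuousMap.toLp 2 μ ℂ : C(Circle, ℂ) →L[ℂ] Lp ℂ 2 μ).continuous h
    fun p hp => Submodule.mem_map_of_mem hp

/-- The canonical map of the disk algebra onto a dense subspace of `H²(μ)`. -/
def diskAlgebraToHardy : diskAlgebra →ₗ[ℂ] hardySpace μ where
  toFun a := ⟨ContinuousMap.toLp 2 μ ℂ (a : C(Circle, ℂ)), toLp_mem_hardySpace μ a.2⟩
  map_add' a b := by ext1; simp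
  map_smul' c a := by ext1; simp

/-- The form `q_μ (g, h) = ∫ conj g * h dμ` on the disk algebra. -/
def measureForm : SesqForm diskAlgebra :=
  have hi : ∀ f g : C(Circle, ℂ), Integrable (fun ζ => conj (f ζ) * g ζ) μ := fun f g =>
    Continuous.integrable_of_hasCompactSupport (by fun_prop) (HasCompactSupport.of_compactSpace _)
  LinearMap.mk₂'ₛₗ (starRingEnd ℂ) (RingHom.id ℂ)
    (fun g h => ∫ ζ, conj ((g : C(Circle, ℂ)) ζ) * (h : C(Circle, ℂ)) ζ ∂μ)
    (fun g₁ g₂ h => by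
      rw [← integral_add (hi _ _) (hi _ _)]
      exact integral_congr_ae (.of_forall fun ζ => by simp [add_mul]))
    (fun c g h => by
      rw [smul_eq_mul, ← integral_const_mul]
      exact integral_congr_ae (.of_forall fun ζ => by simp [mul_assoc]))
    (fun g h₁ h₂ => by
      rw [← integral_add (hi _ _) (hi _ _)]
      exact integral_congr_ae (.of_forall fun ζ => by simp [mul_add]))
    (fun c g h => by
      rw [smul_eq_mul, ← integral_const_mul]
      exact integral_congr_ae (.of_forall fun ζ => by simp [mul_left_comm]))

theorem measureForm_apply (g h : diskAlgebra) :
    measureForm μ g h = ∫ ζ, conj ((g : C(Circle, ℂ)) ζ) * (h : C(Circle, ℂ)) ζ ∂μ := rfl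

end Measure

/-! ### Spaces of Cauchy transforms -/

/-- A vector that is orthogonal to (the images of) all Szegő kernels is zero. -/
theorem eq_zero_of_inner_szegoKernel {H : Type*} [NormedAddCommGroup H] [InnerProductSpace ℂ H]
    (J : diskAlgebra →L[ℂ] H) (hJ : DenseRange J) (f : H)
    (hf : ∀ z, inner ℂ (J ⟨szegoKernel z, szegoKernel_mem z⟩) f = 0) : f = 0 := by
  have h1 : ∀ a : diskAlgebra, inner ℂ (J a) f = 0 := by
    have hcl : closure ((Submodule.span ℂ
        (Set.range fun z => (⟨szegoKernel z, szegoKernel_mem z⟩ : diskAlgebra)) :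
        Submodule ℂ diskAlgebra) : Set diskAlgebra) = Set.univ := by
      refine Set.eq_univ_of_forall fun a => ?_
      have ha := diskAlgebra_le_closure_szegoKernel a.2
      rw [closure_subtype]
      have : Subtype.val '' ((Submodule.span ℂ
          (Set.range fun z => (⟨szegoKernel z, szegoKernel_mem z⟩ : diskAlgebra)) :
          Submodule ℂ diskAlgebra) : Set diskAlgebra) =
          (Submodule.span ℂ (Set.range szegoKernel) : Set C(Circle, ℂ)) := by
        have h := Submodule.map_span diskAlgebra.subtype
          (Set.range fun z => (⟨szegoKernel z, szegoKernel_mem z⟩ : diskAlgebra))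
        have h' := congrArg (fun S : Submodule ℂ C(Circle, ℂ) => (S : Set C(Circle, ℂ))) h
        rw [← Set.range_comp] at h'
        exact h'
      rw [this]
      exact ha
    intro a
    have hc : IsClosed {a : diskAlgebra | inner ℂ (J a) f = 0} :=
      isClosed_eq (by fun_prop) continuous_const
    have hle : ((Submodule.span ℂ
        (Set.range fun z => (⟨szegoKernel z, szegoKernel_mem z⟩ : diskAlgebra)) :
        Submodule ℂ diskAlgebra) : Set diskAlgebra) ⊆ {a : diskAlgebra | inner ℂ (J a) f = 0} := by
      intro b hb
      induction hb using Submodule.span_induction with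
      | mem x hx => obtain ⟨z, rfl⟩ := hx; exact hf z
      | zero => simp
      | add x y _ _ hx hy =>
        simp only [Set.mem_ofPred_eq] at hx hy ⊢
        rw [map_add, inner_add_left, hx, hy, add_zero]
      | smul c x _ hx =>
        simp only [Set.mem_ofPred_eq] at hx ⊢
        rw [map_smul, inner_smul_left, hx, mul_zero]
    exact hc.closure_subset_iff.2 hle (hcl ▸ Set.mem_univ a)
  have h2 : ∀ g : H, inner ℂ g f = 0 := fun g =>
    hJ.induction_on (p := fun g => inner ℂ g f = 0) g
      (isClosed_eq (by fun_prop) continuous_const) h1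
  exact inner_self_eq_zero.1 (h2 f)

section MeasureCauchy

variable (μ : Measure Circle) [IsFiniteMeasure μ]

theorem continuous_diskAlgebraToHardy : Continuous (diskAlgebraToHardy μ) :=
  ((ContinuousMap.toLp 2 μ ℂ : C(Circle, ℂ) →L[ℂ] Lp ℂ 2 μ).continuous.comp
    continuous_subtype_val).subtype_mk _

theorem circleMonomial_mem (n : ℕ) : circleMonomial n ∈ diskAlgebra :=
  ⟨fun w => w ^ n, Differentiable.diffContOnCl (by fun_prop), fun _ => rfl⟩

theorem denseRange_diskAlgebraToHardy : DenseRange (diskAlgebraToHardy μ) := by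
  intro f
  rw [closure_subtype]
  refine closure_mono ?_ f.2
  rintro _ ⟨p, hp, rfl⟩
  have hp' : p ∈ diskAlgebra := by
    refine (Submodule.span_le.2 ?_ : analyticPolynomials ≤ diskAlgebra) hp
    rintro _ ⟨n, rfl⟩
    exact circleMonomial_mem n
  exact ⟨diskAlgebraToHardy μ ⟨p, hp'⟩, ⟨⟨p, hp'⟩, rfl⟩, rfl⟩

/-- The space `ℋ⁺(μ)` of `μ`-Cauchy transforms: its elements are represented by the functions `h`
in `H²(μ)`, with the inner product of `L²(μ)`, and regarded as the functions
`z ↦ ∫ h (ζ) / (1 - z * conj ζ) dμ` on the open unit disk. -/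
def CauchySpace : Type := hardySpace μ

instance : NormedAddCommGroup (CauchySpace μ) := inferInstanceAs (NormedAddCommGroup (hardySpace μ))
instance : InnerProductSpace ℂ (CauchySpace μ) :=
  inferInstanceAs (InnerProductSpace ℂ (hardySpace μ))
instance : CompleteSpace (CauchySpace μ) := inferInstanceAs (CompleteSpace (hardySpace μ))

/-- The Cauchy transform `(C_μ h) (z) = ⟪k_z, h⟫` in `L²(μ)`. -/
def cauchyTransform : CauchySpace μ →L[ℂ] (Complex.UnitDisc → ℂ) :=
  ContinuousLinearMap.pi fun z => (innerSL ℂ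
    (diskAlgebraToHardy μ ⟨szegoKernel z, szegoKernel_mem z⟩) : hardySpace μ →L[ℂ] ℂ)

instance : RKHS ℂ (CauchySpace μ) Complex.UnitDisc ℂ where
  coeCLM := cauchyTransform μ
  coeCLM_injective := by
    refine (injective_iff_map_eq_zero (cauchyTransform μ)).2 fun f hf => ?_
    exact eq_zero_of_inner_szegoKernel ⟨diskAlgebraToHardy μ, continuous_diskAlgebraToHardy μ⟩
      (denseRange_diskAlgebraToHardy μ) f fun z => congrFun hf z

/-- The elements of `ℋ⁺(μ)`, as functions on the disk, are given by the Cauchy integral. -/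
theorem cauchySpace_apply (h : hardySpace μ) (z : Complex.UnitDisc) :
    (show CauchySpace μ from h) z =
      ∫ ζ, (h : Lp ℂ 2 μ) ζ / (1 - (z : ℂ) * conj (ζ : ℂ)) ∂μ := by
  change inner ℂ (ContinuousMap.toLp 2 μ ℂ (szegoKernel z)) (h : Lp ℂ 2 μ) = _
  rw [L2.inner_def]
  refine integral_congr_ae ?_
  filter_upwards [ContinuousMap.coeFn_toLp (p := 2) (𝕜 := ℂ) μ (szegoKernel z)] with ζ hζ
  rw [hζ]
  simp [szegoKernel, div_eq_mul_inv]

end MeasureCauchy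

section FormCauchy

variable (μ : Measure Circle) [IsFiniteMeasure μ] (q : SesqForm diskAlgebra) (hq : q.Nonneg)
  (hle : q.Dominated (measureForm μ))

theorem norm_toCompletion_le (hle : q.Dominated (measureForm μ)) (a : diskAlgebra) :
    ‖q.toCompletion hq a‖ ≤ Real.sqrt (μ.real Set.univ) * ‖a‖ := by
  have h1 : ‖q.toCompletion hq a‖ ^ 2 = (q a a).re := by
    rw [← q.inner_toCompletion hq a a]
    exact (inner_self_eq_norm_sq (𝕜 := ℂ) (q.toCompletion hq a)).symm
  have h2 : (q a a).re ≤ (measureForm μ a a).re := (Complex.le_def.1 (hle a)).1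
  have h3 : (measureForm μ a a).re ≤ ‖a‖ ^ 2 * μ.real Set.univ := by
    refine (Complex.re_le_norm _).trans ?_
    rw [measureForm_apply]
    refine norm_integral_le_of_norm_le_const (.of_forall fun ζ => ?_)
    rw [norm_mul, RCLike.norm_conj, ← sq]
    have := ContinuousMap.norm_coe_le_norm (a : C(Circle, ℂ)) ζ
    gcongr
    exact this
  refine (pow_le_pow_iff_left₀ (norm_nonneg _) (by positivity) two_ne_zero).1 ?_
  rw [mul_pow, Real.sq_sqrt measureReal_nonneg]
  linarith

/-- The canonical map of the disk algebra into the completion for a form below `q_μ`. -/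
def completionMap : diskAlgebra →L[ℂ] q.HilbertCompletion hq :=
  LinearMap.mkContinuous
    { toFun := q.toCompletion hq
      map_add' := fun a b => UniformSpace.Completion.coe_add (α := q.Pre hq) a b
      map_smul' := fun c a => UniformSpace.Completion.coe_smul (X := q.Pre hq) c a }
    (Real.sqrt (μ.real Set.univ)) (norm_toCompletion_le μ q hq hle)

/-- The space `ℋ⁺(q)` of `q`-Cauchy transforms, for a form `0 ≤ q ≤ q_μ` on the disk algebra: its
elements are represented by the vectors `h` in the Hilbert space completion `H²(q)` of the disk
algebra for the pre-inner product `q`, and regarded as the functions `z ↦ q (k_z, h)`. -/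
def FormCauchySpace (_hle : q.Dominated (measureForm μ)) : Type := q.HilbertCompletion hq

instance : NormedAddCommGroup (FormCauchySpace μ q hq hle) :=
  inferInstanceAs (NormedAddCommGroup (q.HilbertCompletion hq))
instance : InnerProductSpace ℂ (FormCauchySpace μ q hq hle) :=
  inferInstanceAs (InnerProductSpace ℂ (q.HilbertCompletion hq))
instance : CompleteSpace (FormCauchySpace μ q hq hle) :=
  inferInstanceAs (CompleteSpace (q.HilbertCompletion hq))

/-- The Cauchy transform `(C_q h) (z) = q (k_z, h)`, where `q` also denotes the inner product of
the completion `H²(q)`. -/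
def formCauchyTransform : FormCauchySpace μ q hq hle →L[ℂ] (Complex.UnitDisc → ℂ) :=
  ContinuousLinearMap.pi fun z => (innerSL ℂ
    (q.toCompletion hq ⟨szegoKernel z, szegoKernel_mem z⟩) : q.HilbertCompletion hq →L[ℂ] ℂ)

instance : RKHS ℂ (FormCauchySpace μ q hq hle) Complex.UnitDisc ℂ where
  coeCLM := formCauchyTransform μ q hq hle
  coeCLM_injective := by
    refine (injective_iff_map_eq_zero (formCauchyTransform μ q hq hle)).2 fun f hf => ?_
    exact eq_zero_of_inner_szegoKernel (completionMap μ q hq hle)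
      (UniformSpace.Completion.denseRange_coe (α := q.Pre hq)) f fun z => congrFun hf z

end FormCauchy

/-! ### Orthogonal sums and intersections of spaces of functions -/

section RKHS

variable {X : Type*}

/-- The vector space of functions underlying a reproducing kernel Hilbert space. -/
def functionsOf (H : Type*) [NormedAddCommGroup H] [InnerProductSpace ℂ H] [RKHS ℂ H X ℂ] :
    Submodule ℂ (X → ℂ) :=
  LinearMap.range (RKHS.coeCLM ℂ : H →L[ℂ] X → ℂ).toLinearMap

/-- `H = K ⊕ L`, an orthogonal direct sum of Hilbert spaces of functions on `X`: the functions of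
`K` and of `L` belong to `H`, with the same inner products, the functions of `K` are orthogonal to
those of `L` in `H`, and every function of `H` is the sum of one of `K` and one of `L`. -/
def IsOrthogonalSum (H K L : Type*)
    [NormedAddCommGroup H] [InnerProductSpace ℂ H] [RKHS ℂ H X ℂ]
    [NormedAddCommGroup K] [InnerProductSpace ℂ K] [RKHS ℂ K X ℂ]
    [NormedAddCommGroup L] [InnerProductSpace ℂ L] [RKHS ℂ L X ℂ] : Prop :=
  ∃ (i : K →ₗᵢ[ℂ] H) (j : L →ₗᵢ[ℂ] H),
    (∀ (f : K) (x : X), i f x = f x) ∧ (∀ (g : L) (x : X), j g x = g x) ∧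
    (∀ (f : K) (g : L), inner ℂ (i f) (j g) = 0) ∧
    ∀ h : H, ∃ (f : K) (g : L), h = i f + j g

end RKHS

/-- The intersection space `int (μ, lam) = ℋ⁺(μ) ∩ ℋ⁺(lam)`. -/
def intersectionSpace (μ lam : Measure Circle) [IsFiniteMeasure μ] [IsFiniteMeasure lam] :
    Submodule ℂ (Complex.UnitDisc → ℂ) :=
  functionsOf (CauchySpace μ) ⊓ functionsOf (CauchySpace lam)

end

noncomputable section

/-! Let `J` and `A` be the canonical maps of the disk algebra into H²(λ) and H²(μ), so that q_μ(a,
b) = ⟪A a, A b⟫. The obstruction to closeability is the closed subspace N of H²(μ) of all limits of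
A u_n along sequences with J u_n → 0 (`multivaluedPart`). Splitting A into its components in N⊥ and
N gives q_ac and q_s, and this works for any linear maps `J`, `A` of a vector space into Hilbert
spaces, with `J` of dense range.

Removing N from the closure of {(J x, A x)} leaves the graph of a closed operator, so q_ac is
closeable (`closeable_regularPart`). Conversely, a closeable form p ≤ q_μ tends to zero along the
sequences that define N, so p cannot see a shift of A x by an element of N (`Closeable.norm_le`).
Shifting by the N-component of A x yields p ≤ q_ac; if moreover p ≤ q_s, the same shift yields p =
0. Uniqueness follows from maximality.

The completions for q_ac and q_s are identified with N⊥ and N. These identifications preserve inner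
products with the Szegő kernels, hence preserve Cauchy transforms, and H²(μ) = N⊥ ⊕ N becomes the
decomposition of ℋ⁺(μ). If k in N has the same Cauchy transform as some h in H²(λ), then ⟪A a, k⟫ =
⟪J a, h⟫ for all a, by density of the Szegő kernels; along a sequence with J u_n → 0 and A u_n → k
this gives ‖k‖² = 0. -/

namespace SesqForm

/-! ### Forms, their completions, and forms induced by linear maps -/

variable {V : Type*} [AddCommGroup V] [Module ℂ V]

/-- Polarization: a sesquilinear form that vanishes on the diagonal is zero. -/
theorem eq_zero_of_diag {q : SesqForm V} (h : ∀ x, q x x = 0) : q = 0 := by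
  ext x y
  have h1 := h (x + y)
  have h2 := h (x + Complex.I • y)
  simp only [map_add, LinearMap.add_apply, LinearMap.map_smulₛₗ, LinearMap.smul_apply,
    smul_eq_mul, Complex.conj_I, RingHom.id_apply, h, zero_add, add_zero, mul_zero] at h1 h2
  have h3 : Complex.I * (q x y - q y x) = 0 := by linear_combination h2
  have h4 : q x y = q y x :=
    sub_eq_zero.1 ((mul_eq_zero.1 h3).resolve_left Complex.I_ne_zero)
  rw [h4, ← two_mul] at h1
  simpa [h4] using h1

theorem Dominated.antisymm {p q : SesqForm V} (h₁ : p.Dominated q) (h₂ : q.Dominated p) :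
    p = q :=
  sub_eq_zero.1 (eq_zero_of_diag fun x => by simp [le_antisymm (h₁ x) (h₂ x)])

/-- The canonical map into the Hilbert space completion, as a linear map. -/
def toCompletionLinear (q : SesqForm V) (hq : q.Nonneg) : V →ₗ[ℂ] q.HilbertCompletion hq where
  toFun := q.toCompletion hq
  map_add' a b := UniformSpace.Completion.coe_add (α := q.Pre hq) a b
  map_smul' c a := UniformSpace.Completion.coe_smul (X := q.Pre hq) c a

theorem norm_sq_toCompletionLinear (q : SesqForm V) (hq : q.Nonneg) (a : V) :
    ‖q.toCompletionLinear hq a‖ ^ 2 = (q a a).re := by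
  rw [← q.inner_toCompletion hq a a]
  exact (inner_self_eq_norm_sq (𝕜 := ℂ) (q.toCompletion hq a)).symm

theorem denseRange_toCompletionLinear (q : SesqForm V) (hq : q.Nonneg) :
    DenseRange (q.toCompletionLinear hq) :=
  UniformSpace.Completion.denseRange_coe (α := q.Pre hq)

section Inner

variable {K : Type*} [NormedAddCommGroup K] [InnerProductSpace ℂ K]

/-- The form `(x, y) ↦ ⟪T x, T y⟫` of a linear map `T` into an inner product space. -/
def ofLinearMap (T : V →ₗ[ℂ] K) : SesqForm V :=
  LinearMap.mk₂'ₛₗ (starRingEnd ℂ) (RingHom.id ℂ) (fun x y => inner ℂ (T x) (T y))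
    (fun x y z => by rw [map_add, inner_add_left])
    (fun c x y => by rw [map_smul, inner_smul_left, smul_eq_mul])
    (fun x y z => by rw [map_add, inner_add_right])
    (fun c x y => by rw [map_smul, inner_smul_right, smul_eq_mul, RingHom.id_apply])

theorem ofLinearMap_apply (T : V →ₗ[ℂ] K) (x y : V) :
    ofLinearMap T x y = inner ℂ (T x) (T y) := rfl

theorem ofLinearMap_self (T : V →ₗ[ℂ] K) (x : V) :
    ofLinearMap T x x = ((‖T x‖ ^ 2 : ℝ) : ℂ) := by
  rw [ofLinearMap_apply, inner_self_eq_norm_sq_to_K]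
  push_cast
  rfl

theorem nonneg_ofLinearMap (T : V →ₗ[ℂ] K) : (ofLinearMap T).Nonneg := fun x => by
  rw [ofLinearMap_self, Complex.zero_le_real]
  positivity

theorem norm_toCompletionLinear_ofLinearMap (T : V →ₗ[ℂ] K) (h : (ofLinearMap T).Nonneg) (x : V) :
    ‖(ofLinearMap T).toCompletionLinear h x‖ = ‖T x‖ := by
  rw [← pow_left_inj₀ (norm_nonneg _) (norm_nonneg _) two_ne_zero, norm_sq_toCompletionLinear,
    ofLinearMap_self, Complex.ofReal_re]

/-- Turns the order of forms into a comparison of seminorms, which makes the triangle inequality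
available. Both diagonals are real, so only real parts have to be compared. -/
theorem dominated_ofLinearMap_iff (T : V →ₗ[ℂ] K) {p : SesqForm V} (hp : p.Nonneg) :
    p.Dominated (ofLinearMap T) ↔ ∀ x, ‖p.toCompletionLinear hp x‖ ≤ ‖T x‖ := by
  refine forall_congr' fun x => ?_
  rw [← pow_le_pow_iff_left₀ (norm_nonneg _) (norm_nonneg _) two_ne_zero,
    norm_sq_toCompletionLinear, ofLinearMap_self, Complex.le_def]
  have := (Complex.nonneg_iff.1 (hp x)).2
  simp [← this, -Complex.ofReal_pow]

/-- The completion for the form `(x, y) ↦ ⟪T x, T y⟫` is the closure of the range of `T`. -/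
theorem exists_isometry_completion [CompleteSpace K] (T : V →ₗ[ℂ] K)
    (h : (ofLinearMap T).Nonneg) :
    ∃ i : (ofLinearMap T).HilbertCompletion h →ₗᵢ[ℂ] K,
      (∀ x, i ((ofLinearMap T).toCompletion h x) = T x) ∧
        Set.range i = closure (Set.range T) := by
  set e := (ofLinearMap T).toCompletionLinear h with he
  have hd : DenseRange e := denseRange_toCompletionLinear _ h
  have hn : ∀ x, ‖e x‖ = ‖T x‖ := norm_toCompletionLinear_ofLinearMap T h
  have hC : ∃ C, ∀ x, ‖T x‖ ≤ C * ‖e x‖ := ⟨1, fun x => by rw [hn, one_mul]⟩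
  have hE : ∀ x, T.extendOfNorm e (e x) = T x := fun x => T.extendOfNorm_eq hd hC x
  let i : (ofLinearMap T).HilbertCompletion h →ₗᵢ[ℂ] K :=
    { toLinearMap := (T.extendOfNorm e).toLinearMap
      norm_map' := fun f => hd.induction_on
        (p := fun f => ‖T.extendOfNorm e f‖ = ‖f‖) f
        (isClosed_eq (T.extendOfNorm e).continuous.norm continuous_norm)
        fun x => by rw [hE, hn] }
  have hi : ∀ x, i (e x) = T x := hE
  -- An isometry on a complete space has closed range, so it is enough that the range of `i`
  -- contains every `T x`.
  refine ⟨i, hi, subset_antisymm ?_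
    (closure_minimal ?_ i.isometry.isClosedEmbedding.isClosed_range)⟩
  · rintro _ ⟨f, rfl⟩
    exact hd.induction_on (p := fun f => i f ∈ closure (Set.range T)) f
      (isClosed_closure.preimage i.continuous) fun x => by
        rw [hi]; exact subset_closure ⟨x, rfl⟩
  · rintro _ ⟨x, rfl⟩
    exact ⟨e x, hi x⟩

end Inner

/-! ### The closure of the relation {(J x, A x)} and its multivalued part -/

section Decomposition

variable {H : Type*} [NormedAddCommGroup H] [InnerProductSpace ℂ H]
  {K : Type*} [NormedAddCommGroup K] [InnerProductSpace ℂ K]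

/-- The closure of the relation `{(J x, A x)}`. -/
def closedRelation (J : V →ₗ[ℂ] H) (A : V →ₗ[ℂ] K) : Submodule ℂ (H × K) :=
  (LinearMap.range (J.prod A)).topologicalClosure

/-- The multivalued part `{k | (0, k) ∈ closure {(J x, A x)}}` of the closure of the relation
`{(J x, A x)}`. -/
def multivaluedPart (J : V →ₗ[ℂ] H) (A : V →ₗ[ℂ] K) : Submodule ℂ K :=
  (closedRelation J A).comap (LinearMap.inr ℂ H K)

variable (J : V →ₗ[ℂ] H) (A : V →ₗ[ℂ] K)

theorem isClosed_closedRelation : IsClosed (closedRelation J A : Set (H × K)) :=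
  Submodule.isClosed_topologicalClosure _

theorem mem_closedRelation (x : V) : (J x, A x) ∈ closedRelation J A :=
  Submodule.le_topologicalClosure _ ⟨x, rfl⟩

theorem mem_multivaluedPart {k : K} :
    k ∈ multivaluedPart J A ↔ ((0 : H), k) ∈ closedRelation J A := Iff.rfl

theorem isClosed_multivaluedPart : IsClosed (multivaluedPart J A : Set K) :=
  (isClosed_closedRelation J A).preimage (f := fun k : K => ((0 : H), k)) (by fun_prop)

instance [CompleteSpace K] : CompleteSpace (multivaluedPart J A) :=
  (isClosed_multivaluedPart J A).completeSpace_coe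

theorem exists_seq_of_mem_multivaluedPart {k : K} (hk : k ∈ multivaluedPart J A) :
    ∃ u : ℕ → V, Tendsto (fun n => J (u n)) atTop (𝓝 0) ∧
      Tendsto (fun n => A (u n)) atTop (𝓝 k) := by
  obtain ⟨w, hw, hlim⟩ := mem_closure_iff_seq_limit.1 ((mem_multivaluedPart J A).1 hk)
  choose u hu using hw
  rw [nhds_prod_eq, tendsto_prod_iff'] at hlim
  refine ⟨u, hlim.1.congr fun n => ?_, hlim.2.congr fun n => ?_⟩ <;> rw [← hu n] <;> rfl

/-- A linear functional on `H`, seen through `J`, that is also given by a vector of the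
multivalued part is zero. -/
theorem eq_zero_of_mem_multivaluedPart {k : K} (hk : k ∈ multivaluedPart J A) (h : H)
    (heq : ∀ x, inner ℂ (A x) k = inner ℂ (J x) h) : k = 0 := by
  obtain ⟨u, hJ, hA⟩ := exists_seq_of_mem_multivaluedPart J A hk
  -- The same scalars tend to ‖k‖² because A u_n → k, and to 0 because J u_n → 0.
  have h1 : Tendsto (fun n => inner ℂ (A (u n)) k) atTop (𝓝 (inner ℂ k k)) :=
    hA.inner tendsto_const_nhds
  have h2 : Tendsto (fun n => inner ℂ (J (u n)) h) atTop (𝓝 (inner ℂ 0 h)) :=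
    hJ.inner tendsto_const_nhds
  simp only [heq] at h1
  rw [inner_zero_left] at h2
  exact inner_self_eq_zero.1 (tendsto_nhds_unique h1 h2)

/-! ### Closeable forms do not see the multivalued part -/

variable {J} in
/-- Along a sequence that converges to zero in `H` and is Cauchy for a closeable form, the form
tends to zero. -/
theorem Closeable.tendsto_zero {p : SesqForm V} (hc : p.Closeable J) (hp : p.Nonneg) {u : ℕ → V}
    (hJ : Tendsto (fun n => J (u n)) atTop (𝓝 0))
    (hu : Tendsto (fun n : ℕ × ℕ => ‖p.toCompletionLinear hp (u n.1 - u n.2)‖) atTop (𝓝 0)) :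
    Tendsto (fun n => ‖p.toCompletionLinear hp (u n)‖) atTop (𝓝 0) := by
  obtain ⟨t, htJ, ht⟩ := hc
  have hpq : ∀ x, (p x x).re = ‖p.toCompletionLinear hp x‖ ^ 2 := fun x =>
    (norm_sq_toCompletionLinear p hp x).symm
  let v : ℕ → t.domain := fun n => ⟨J (u n), htJ _⟩
  have hv : ∀ n m, v n - v m = ⟨J (u n - u m), htJ _⟩ := fun n m => by
    ext1; simp [v]
  obtain ⟨x, hx⟩ := t.complete v (by
    have hJ' : Tendsto (fun n : ℕ × ℕ => ‖J (u n.1 - u n.2)‖) atTop (𝓝 0) := by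
      simpa [dist_eq_norm] using cauchySeq_iff_tendsto_dist_atTop_0.1 hJ.cauchySeq
    have := (hJ'.pow 2).add (hu.pow 2)
    simp only [ne_eq, OfNat.ofNat_ne_zero, not_false_eq_true, zero_pow, add_zero] at this
    refine this.congr fun n => ?_
    rw [hv, ht, hpq]
    rfl)
  have hnn : ∀ y : t.domain, 0 ≤ (t.form y y).re := fun y => (Complex.nonneg_iff.1 (t.nonneg y)).1
  -- Convergence for the norm of the closed extension implies convergence in `H`, where the limit is
  -- already known to be 0.
  have hx0 : x = 0 := by
    have h1 : Tendsto (fun n => ‖v n - x‖ ^ 2) atTop (𝓝 0) :=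
      squeeze_zero (fun n => by positivity) (fun n => le_add_of_nonneg_right (hnn _)) hx
    have h2 : Tendsto (fun n => ‖v n - x‖ ^ 2) atTop (𝓝 (‖(0 : H) - x‖ ^ 2)) :=
      (hJ.sub tendsto_const_nhds).norm.pow 2
    have h3 := tendsto_nhds_unique h2 h1
    ext1
    simpa using h3
  subst hx0
  have h1 : Tendsto (fun n => ‖p.toCompletionLinear hp (u n)‖ ^ 2) atTop (𝓝 0) := by
    refine squeeze_zero (fun n => by positivity) (fun n => ?_) hx
    rw [sub_zero, ht, hpq]
    exact le_add_of_nonneg_left (by positivity)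
  have h2 := h1.sqrt
  simpa [Real.sqrt_sq (norm_nonneg _)] using h2

/-- A closeable form below `⟪A x, A y⟫` and below `⟪B (A x), B (A y)⟫` is below
`⟪B (A x - k), B (A x - k)⟫`, for `k` in the multivalued part. -/
theorem Closeable.norm_le {p : SesqForm V} (hc : p.Closeable J) (hp : p.Nonneg)
    (hA : ∀ x, ‖p.toCompletionLinear hp x‖ ≤ ‖A x‖) (B : K →L[ℂ] K)
    (hB : ∀ x, ‖p.toCompletionLinear hp x‖ ≤ ‖B (A x)‖) {k : K} (hk : k ∈ multivaluedPart J A)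
    (x : V) : ‖p.toCompletionLinear hp x‖ ≤ ‖B (A x - k)‖ := by
  obtain ⟨u, hJu, hAu⟩ := exists_seq_of_mem_multivaluedPart J A hk
  have hcau : Tendsto (fun n : ℕ × ℕ => ‖A (u n.1 - u n.2)‖) atTop (𝓝 0) := by
    simpa [dist_eq_norm] using cauchySeq_iff_tendsto_dist_atTop_0.1 hAu.cauchySeq
  have h0 := hc.tendsto_zero hp hJu (squeeze_zero (fun _ => norm_nonneg _) (fun n => hA _) hcau)
  have h1 : Tendsto (fun n => ‖B (A x - A (u n))‖) atTop (𝓝 ‖B (A x - k)‖) :=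
    ((B.continuous.tendsto _).comp (tendsto_const_nhds.sub hAu)).norm
  have h2 := h1.add h0
  rw [add_zero] at h2
  -- Replacing x by x - u_n costs only the p-seminorm of u_n, which tends to 0, while B (A (x -
  -- u_n)) tends to B (A x - k).
  refine ge_of_tendsto' h2 fun n => ?_
  calc ‖p.toCompletionLinear hp x‖
      = ‖p.toCompletionLinear hp (x - u n) + p.toCompletionLinear hp (u n)‖ := by
        rw [← map_add, sub_add_cancel]
    _ ≤ ‖p.toCompletionLinear hp (x - u n)‖ + ‖p.toCompletionLinear hp (u n)‖ := norm_add_le _ _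
    _ ≤ _ := by
        gcongr
        rw [← map_sub]
        exact hB _

/-! ### Closed forms from closed operators, and uniqueness of the decomposition -/

theorem _root_.cauchySeq_of_norm_sq_sub_le {E : Type*} [SeminormedAddCommGroup E] {f : ℕ → E}
    {b : ℕ × ℕ → ℝ} (hb : Tendsto b atTop (𝓝 0)) (hf : ∀ p, ‖f p.1 - f p.2‖ ^ 2 ≤ b p) :
    CauchySeq f := by
  rw [cauchySeq_iff_tendsto_dist_atTop_0]
  have := (squeeze_zero (fun p => by positivity) hf hb).sqrt
  simpa [Real.sqrt_sq (norm_nonneg _), dist_eq_norm] using this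

/-- A closed operator, that is, a closed subspace `G` of `H × K` without vertical vectors and with
dense domain, defines the closed form `⟪S x, S y⟫`. -/
def _root_.ClosedForm.ofClosedGraph [CompleteSpace H] [CompleteSpace K] (G : Submodule ℂ (H × K))
    (hG : IsClosed (G : Set (H × K))) (h0 : ∀ x ∈ G, x.1 = 0 → x.2 = 0)
    (hd : Dense (G.map (LinearMap.fst ℂ H K) : Set H)) : ClosedForm H where
  domain := G.map (LinearMap.fst ℂ H K)
  dense_domain := hd
  form := ofLinearMap G.toLinearPMap.toFun
  nonneg := nonneg_ofLinearMap _
  complete u hu := by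
    set S : G.map (LinearMap.fst ℂ H K) →ₗ[ℂ] K := G.toLinearPMap.toFun
    have hS : ∀ x : G.map (LinearMap.fst ℂ H K), ((x : H), S x) ∈ G := fun x =>
      G.mem_graph_toLinearPMap h0 x
    simp only [ofLinearMap_self, Complex.ofReal_re] at hu ⊢
    -- A Cauchy sequence for the graph norm converges in each component; closedness puts the limit
    -- (x, k) in `G`, and the absence of vertical vectors forces k = S x.
    obtain ⟨x, hx⟩ := cauchySeq_tendsto_of_complete (cauchySeq_of_norm_sq_sub_le hu
      (f := fun n => (u n : H)) fun p => le_add_of_nonneg_right (by positivity))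
    obtain ⟨k, hk⟩ := cauchySeq_tendsto_of_complete (cauchySeq_of_norm_sq_sub_le hu
      (f := fun n => S (u n)) fun p => by
        rw [← map_sub]; exact le_add_of_nonneg_left (by positivity))
    have hxk : (x, k) ∈ G := hG.mem_of_tendsto (hx.prodMk_nhds hk) (.of_forall fun n => hS _)
    have hxd : x ∈ G.map (LinearMap.fst ℂ H K) := ⟨(x, k), hxk, rfl⟩
    have hSx : S ⟨x, hxd⟩ = k := by
      have := h0 _ (G.sub_mem (hS ⟨x, hxd⟩) hxk) (by simp)
      exact sub_eq_zero.1 this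
    refine ⟨⟨x, hxd⟩, ?_⟩
    have h1 : Tendsto (fun n => ‖(u n : H) - x‖ ^ 2 + ‖S (u n) - k‖ ^ 2) atTop
        (𝓝 (‖x - x‖ ^ 2 + ‖k - k‖ ^ 2)) :=
      ((hx.sub_const x).norm.pow 2).add ((hk.sub_const k).norm.pow 2)
    simp only [sub_self, norm_zero, ne_eq, OfNat.ofNat_ne_zero, not_false_eq_true, zero_pow,
      add_zero] at h1
    refine h1.congr fun n => ?_
    rw [map_sub, hSx]
    rfl

/-- Each absolutely continuous part is a competitor in the maximality of the other, so they dominate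
each other and agree; the singular parts are then equal by cancellation. -/
theorem IsSimonLebesgueDecomposition.unique {q p₁ s₁ p₂ s₂ : SesqForm V}
    (h₁ : IsSimonLebesgueDecomposition J q p₁ s₁) (h₂ : IsSimonLebesgueDecomposition J q p₂ s₂) :
    p₁ = p₂ ∧ s₁ = s₂ := by
  have h : p₁ = p₂ := (h₂.maximal_ac _ h₁.nonneg_ac h₁.closeable_ac h₁.ac_le).antisymm
    (h₁.maximal_ac _ h₂.nonneg_ac h₂.closeable_ac h₂.ac_le)
  subst h
  exact ⟨rfl, add_left_cancel (h₁.add_eq.symm.trans h₂.add_eq)⟩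

/-- The projection is continuous and fixes `N` pointwise, so approximating a vector of `N` by values
of `A` and projecting stays an approximation. -/
theorem subset_closure_range_starProjection_comp (N : Submodule ℂ K) [N.HasOrthogonalProjection]
    (hA : DenseRange A) :
    (N : Set K) ⊆ closure (Set.range (N.starProjection.toLinearMap ∘ₗ A)) := by
  intro k hk
  have h := mem_closure_image (N.starProjection.continuous.continuousAt) (hA k)
  rw [Submodule.starProjection_eq_self_iff.2 hk, ← Set.range_comp] at h
  exact h

/-! ### The regular and singular parts, and Simon's decomposition -/

variable [CompleteSpace K]

/-- The part of `A` orthogonal to the multivalued part. -/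
def regularPart : V →ₗ[ℂ] K := (multivaluedPart J A)ᗮ.starProjection.toLinearMap ∘ₗ A

/-- The part of `A` in the multivalued part. -/
def singularPart : V →ₗ[ℂ] K := (multivaluedPart J A).starProjection.toLinearMap ∘ₗ A

theorem regularPart_mem (x : V) : regularPart J A x ∈ (multivaluedPart J A)ᗮ :=
  Submodule.starProjection_apply_mem _ _

theorem singularPart_mem (x : V) : singularPart J A x ∈ multivaluedPart J A :=
  Submodule.starProjection_apply_mem _ _

theorem singularPart_add_regularPart (x : V) : singularPart J A x + regularPart J A x = A x :=
  Submodule.starProjection_add_starProjection_orthogonal _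

/-- Pythagoras in polarized form: the cross terms pair N with N⊥. -/
theorem ofLinearMap_eq_add : ofLinearMap A =
    ofLinearMap (regularPart J A) + ofLinearMap (singularPart J A) := by
  ext x y
  rw [LinearMap.add_apply, LinearMap.add_apply, ofLinearMap_apply, ofLinearMap_apply,
    ofLinearMap_apply, ← singularPart_add_regularPart J A x, ← singularPart_add_regularPart J A y,
    inner_add_left, inner_add_right, inner_add_right,
    Submodule.inner_right_of_mem_orthogonal (singularPart_mem J A x) (regularPart_mem J A y),
    Submodule.inner_left_of_mem_orthogonal (singularPart_mem J A y) (regularPart_mem J A x)]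
  ring

/-- Intersecting the closed relation with H × N⊥ leaves a closed graph `G`: if (0, k) lies in it,
then k is in both N and N⊥. The form of this closed operator is the required extension. -/
theorem closeable_regularPart [CompleteSpace H] (hJ : DenseRange J) :
    (ofLinearMap (regularPart J A)).Closeable J := by
  set N := multivaluedPart J A with hN
  let G : Submodule ℂ (H × K) := closedRelation J A ⊓ Nᗮ.comap (LinearMap.snd ℂ H K)
  have hG : IsClosed (G : Set (H × K)) :=
    (isClosed_closedRelation J A).inter (N.isClosed_orthogonal.preimage continuous_snd)
  have h0 : ∀ x ∈ G, x.1 = 0 → x.2 = 0 := by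
    rintro ⟨h, k⟩ ⟨h1, h2⟩ rfl
    exact inner_self_eq_zero.1 (Submodule.inner_right_of_mem_orthogonal (K := N) h1 h2)
  -- Subtract from (J x, A x) the vertical vector (0, `singularPart J A x`), which lies in the
  -- closed relation by definition of N.
  have hmem : ∀ x, (J x, regularPart J A x) ∈ G := by
    refine fun x => ⟨?_, regularPart_mem J A x⟩
    have := (closedRelation J A).sub_mem (mem_closedRelation J A x)
      ((mem_multivaluedPart J A).1 (singularPart_mem J A x))
    rwa [Prod.mk_sub_mk, sub_zero, ← singularPart_add_regularPart J A x, add_sub_cancel_left]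
      at this
  have hdom : ∀ x, J x ∈ G.map (LinearMap.fst ℂ H K) := fun x => ⟨_, hmem x, rfl⟩
  refine ⟨ClosedForm.ofClosedGraph G hG h0 (hJ.mono ?_), hdom, fun x y => ?_⟩
  · rintro _ ⟨x, rfl⟩
    exact hdom x
  · have key : ∀ x, G.toLinearPMap.toFun ⟨J x, hdom x⟩ = regularPart J A x := fun x => by
      have := h0 _ (G.sub_mem (G.mem_graph_toLinearPMap h0 ⟨J x, hdom x⟩) (hmem x)) (by simp)
      exact sub_eq_zero.1 this
    change inner ℂ (G.toLinearPMap.toFun ⟨J x, hdom x⟩) (G.toLinearPMap.toFun ⟨J y, hdom y⟩) = _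
    rw [key, key, ofLinearMap_apply]

/-- Simon's construction of the Lebesgue decomposition. -/
theorem isSimonLebesgueDecomposition_ofLinearMap [CompleteSpace H] (hJ : DenseRange J) :
    IsSimonLebesgueDecomposition J (ofLinearMap A) (ofLinearMap (regularPart J A))
      (ofLinearMap (singularPart J A)) := by
  have hR := nonneg_ofLinearMap (regularPart J A)
  have hS := nonneg_ofLinearMap (singularPart J A)
  have hadd := ofLinearMap_eq_add J A
  have hSA : (ofLinearMap (singularPart J A)).Dominated (ofLinearMap A) := fun x => by
    rw [hadd]; exact le_add_of_nonneg_left (hR x)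
  refine ⟨hadd, hR, hS, fun x => ?_, hSA, closeable_regularPart J A hJ,
    fun p hp hc hle => ?_, fun p hp hc hle => ?_⟩
  · rw [hadd]; exact le_add_of_nonneg_right (hS x)
  · have hA := (dominated_ofLinearMap_iff A hp).1 hle
    rw [dominated_ofLinearMap_iff _ hp]
    intro x
    -- With B the identity and k the N-component of A x, the bound becomes the norm of the regular
    -- part.
    have := hc.norm_le J A hp hA (.id ℂ K) hA (singularPart_mem J A x) x
    rwa [ContinuousLinearMap.id_apply, ← singularPart_add_regularPart J A x,
      add_sub_cancel_left] at this
  · have hA := (dominated_ofLinearMap_iff A hp).1 fun x => (hle x).trans (hSA x)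
    have hB := (dominated_ofLinearMap_iff _ hp).1 hle
    refine eq_zero_of_diag fun x => ?_
    -- With B the projection onto N and the same k, the vector A x - k lies in N⊥, so the bound is
    -- 0.
    have h1 := hc.norm_le J A hp hA (multivaluedPart J A).starProjection hB
      (singularPart_mem J A x) x
    rw [← singularPart_add_regularPart J A x, add_sub_cancel_left,
      (Submodule.starProjection_apply_eq_zero_iff _).2 (regularPart_mem J A x), norm_zero] at h1
    have h2 := norm_sq_toCompletionLinear p hp x
    rw [le_antisymm h1 (norm_nonneg _)] at h2
    have h3 := Complex.nonneg_iff.1 (hp x)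
    exact Complex.ext (by simpa using h2.symm) h3.2.symm

/-- The completions for the two parts of the decomposition are complementary orthogonal subspaces
of `K`. -/
theorem exists_isometries_completion (hA : DenseRange A)
    (hR : (ofLinearMap (regularPart J A)).Nonneg) (hS : (ofLinearMap (singularPart J A)).Nonneg) :
    ∃ (i : (ofLinearMap (regularPart J A)).HilbertCompletion hR →ₗᵢ[ℂ] K)
      (j : (ofLinearMap (singularPart J A)).HilbertCompletion hS →ₗᵢ[ℂ] K),
      (∀ f x, inner ℂ (A x) (i f) = inner ℂ (toCompletion _ hR x) f) ∧
      (∀ g x, inner ℂ (A x) (j g) = inner ℂ (toCompletion _ hS x) g) ∧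
      (∀ f g, inner ℂ (i f) (j g) = 0) ∧ (∀ h, ∃ f g, h = i f + j g) ∧
      ∀ g, j g ∈ multivaluedPart J A := by
  obtain ⟨i, hi, hir⟩ := exists_isometry_completion (regularPart J A) hR
  obtain ⟨j, hj, hjr⟩ := exists_isometry_completion (singularPart J A) hS
  set N := multivaluedPart J A with hN
  have hiN : ∀ f, i f ∈ Nᗮ := fun f => closure_minimal
    (Set.range_subset_iff.2 (regularPart_mem J A)) N.isClosed_orthogonal (hir ▸ ⟨f, rfl⟩)
  have hjN : ∀ f, j f ∈ N := fun f => closure_minimal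
    (Set.range_subset_iff.2 (singularPart_mem J A))
    (isClosed_multivaluedPart J A) (hjr ▸ ⟨f, rfl⟩)
  refine ⟨i, j, fun f x => ?_, fun g x => ?_,
    fun f g => Submodule.inner_left_of_mem_orthogonal (hjN g) (hiN f), fun h => ?_, hjN⟩
  · rw [← i.inner_map_map, hi, ← singularPart_add_regularPart J A x, inner_add_left,
      Submodule.inner_right_of_mem_orthogonal (singularPart_mem J A x) (hiN f), zero_add]
  · rw [← j.inner_map_map, hj, ← singularPart_add_regularPart J A x, inner_add_left,
      Submodule.inner_left_of_mem_orthogonal (hjN g) (regularPart_mem J A x), add_zero]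
  -- Since `A` has dense range, its projections are dense in N⊥ and N, so the ranges of `i` and `j`
  -- contain these subspaces.
  · obtain ⟨f, hf⟩ : Nᗮ.starProjection h ∈ Set.range i := hir ▸
      subset_closure_range_starProjection_comp A Nᗮ hA (Submodule.starProjection_apply_mem _ _)
    obtain ⟨g, hg⟩ : N.starProjection h ∈ Set.range j := hjr ▸
      subset_closure_range_starProjection_comp A N hA (Submodule.starProjection_apply_mem _ _)
    exact ⟨f, g, by rw [hf, hg, add_comm, N.starProjection_add_starProjection_orthogonal h]⟩

end Decomposition

end SesqForm

/-! ### Application to measures and Cauchy transforms -/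

theorem measureForm_eq_ofLinearMap (μ : Measure Circle) [IsFiniteMeasure μ] :
    measureForm μ = SesqForm.ofLinearMap (diskAlgebraToHardy μ) := by
  ext a b
  rw [measureForm_apply, SesqForm.ofLinearMap_apply]
  refine Eq.trans ?_ (ContinuousMap.inner_toLp (𝕜 := ℂ) μ (a : C(Circle, ℂ)) b).symm
  exact integral_congr_ae (.of_forall fun ζ => mul_comm _ _)

/-- Vectors with the same Cauchy transform define the same functional on the disk algebra. -/
theorem inner_eq_of_inner_szegoKernel (μ lam : Measure Circle) [IsFiniteMeasure μ]
    [IsFiniteMeasure lam] (k : hardySpace μ) (h : hardySpace lam)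
    (hz : ∀ z, inner ℂ (diskAlgebraToHardy μ ⟨szegoKernel z, szegoKernel_mem z⟩) k =
      inner ℂ (diskAlgebraToHardy lam ⟨szegoKernel z, szegoKernel_mem z⟩) h) (a : diskAlgebra) :
    inner ℂ (diskAlgebraToHardy μ a) k = inner ℂ (diskAlgebraToHardy lam a) h := by
  -- The conjugate of the difference of the two sides, which is linear and continuous in a and
  -- vanishes on the Szegő kernels.
  let φ : diskAlgebra →L[ℂ] ℂ :=
    (innerSL ℂ k).comp ⟨diskAlgebraToHardy μ, continuous_diskAlgebraToHardy μ⟩ -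
      (innerSL ℂ h).comp ⟨diskAlgebraToHardy lam, continuous_diskAlgebraToHardy lam⟩
  have hφ : ∀ b, φ b = inner ℂ k (diskAlgebraToHardy μ b) - inner ℂ h (diskAlgebraToHardy lam b) :=
    fun b => rfl
  have h0 : φ a = 0 := by
    by_contra hne
    -- A nonzero functional is onto ℂ, so `eq_zero_of_inner_szegoKernel` applies with ℂ as Hilbert
    -- space and makes the vector 1 vanish.
    have hsurj : Function.Surjective φ := fun c =>
      ⟨(c / φ a) • a, by rw [map_smul, smul_eq_mul, div_mul_cancel₀ _ hne]⟩
    refine one_ne_zero (eq_zero_of_inner_szegoKernel φ hsurj.denseRange (1 : ℂ) fun z => ?_)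
    rw [hφ, ← inner_conj_symm k, ← inner_conj_symm h, hz, sub_self, inner_zero_left]
  rw [hφ, sub_eq_zero, ← inner_conj_symm k, ← inner_conj_symm h] at h0
  exact (starRingEnd ℂ).injective h0

/-- The value at z of an element of either kind of space is an inner product with k_z, so `hi` and
`hj` at a = k_z say that `i` and `j` leave the functions unchanged. -/
theorem isOrthogonalSum_formCauchySpace (μ : Measure Circle) [IsFiniteMeasure μ]
    {p s : SesqForm diskAlgebra} (hp : p.Nonneg) (hpμ : p.Dominated (measureForm μ))
    (hs : s.Nonneg) (hsμ : s.Dominated (measureForm μ))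
    (i : p.HilbertCompletion hp →ₗᵢ[ℂ] hardySpace μ)
    (j : s.HilbertCompletion hs →ₗᵢ[ℂ] hardySpace μ)
    (hi : ∀ f a, inner ℂ (diskAlgebraToHardy μ a) (i f) = inner ℂ (p.toCompletion hp a) f)
    (hj : ∀ g a, inner ℂ (diskAlgebraToHardy μ a) (j g) = inner ℂ (s.toCompletion hs a) g)
    (hij : ∀ f g, inner ℂ (i f) (j g) = 0) (hsum : ∀ h, ∃ f g, h = i f + j g) :
    IsOrthogonalSum (CauchySpace μ) (FormCauchySpace μ p hp hpμ) (FormCauchySpace μ s hs hsμ) :=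
  ⟨i, j, fun f z => hi f ⟨szegoKernel z, szegoKernel_mem z⟩,
    fun g z => hj g ⟨szegoKernel z, szegoKernel_mem z⟩, hij, hsum⟩

theorem functionsOf_formCauchySpace_inf_intersectionSpace (μ lam : Measure Circle)
    [IsFiniteMeasure μ] [IsFiniteMeasure lam] {s : SesqForm diskAlgebra} (hs : s.Nonneg)
    (hsμ : s.Dominated (measureForm μ)) (j : s.HilbertCompletion hs →ₗᵢ[ℂ] hardySpace μ)
    (hj : ∀ g a, inner ℂ (diskAlgebraToHardy μ a) (j g) = inner ℂ (s.toCompletion hs a) g)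
    (hjN : ∀ g, j g ∈
      SesqForm.multivaluedPart (diskAlgebraToHardy lam) (diskAlgebraToHardy μ)) :
    functionsOf (FormCauchySpace μ s hs hsμ) ⊓ intersectionSpace μ lam = ⊥ := by
  rw [eq_bot_iff]
  rintro F ⟨⟨g, hg⟩, -, ⟨h, hh⟩⟩
  have hz := inner_eq_of_inner_szegoKernel μ lam (j g) h fun z =>
    (hj g _).trans (congrFun (hg.trans hh.symm) z)
  have hjg := SesqForm.eq_zero_of_mem_multivaluedPart _ _ (hjN g) h hz
  have hg0 : g = 0 := j.injective (hjg.trans (map_zero j).symm)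
  rw [Submodule.mem_bot, ← hg, hg0]
  exact map_zero (formCauchyTransform μ s hs hsμ)

theorem corollary5p12 (μ lam : Measure Circle) [IsFiniteMeasure μ] [IsFiniteMeasure lam] :
    (∃! d : SesqForm diskAlgebra × SesqForm diskAlgebra,
      SesqForm.IsSimonLebesgueDecomposition (diskAlgebraToHardy lam) (measureForm μ) d.1 d.2) ∧
    ∀ (q_ac q_s : SesqForm diskAlgebra)
      (hd : SesqForm.IsSimonLebesgueDecomposition (diskAlgebraToHardy lam) (measureForm μ)
        q_ac q_s),
      IsOrthogonalSum (CauchySpace μ)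
        (FormCauchySpace μ q_ac hd.nonneg_ac hd.ac_le) (FormCauchySpace μ q_s hd.nonneg_s hd.s_le) ∧
      functionsOf (FormCauchySpace μ q_s hd.nonneg_s hd.s_le) ⊓ intersectionSpace μ lam = ⊥ := by
  have hdec := SesqForm.isSimonLebesgueDecomposition_ofLinearMap (diskAlgebraToHardy lam)
    (diskAlgebraToHardy μ) (denseRange_diskAlgebraToHardy lam)
  rw [← measureForm_eq_ofLinearMap μ] at hdec
  refine ⟨⟨(_, _), hdec, fun d hd => Prod.ext (hd.unique _ hdec).1 (hd.unique _ hdec).2⟩, ?_⟩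
  intro q_ac q_s hd
  -- By uniqueness the given decomposition is the one obtained by projecting onto N⊥ and N.
  obtain ⟨rfl, rfl⟩ := hd.unique _ hdec
  obtain ⟨i, j, hi, hj, hij, hsum, hjN⟩ := SesqForm.exists_isometries_completion
    (diskAlgebraToHardy lam) (diskAlgebraToHardy μ) (denseRange_diskAlgebraToHardy μ)
    hd.nonneg_ac hd.nonneg_s
  exact ⟨isOrthogonalSum_formCauchySpace μ _ _ _ _ i j hi hj hij hsum,
    functionsOf_formCauchySpace_inf_intersectionSpace μ lam _ _ j hj hjN⟩

end
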